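/- Let $p\ge 0$ be fixed, $\beta^*\in\mathbb{R}^p$, $S=\{j:\beta^*_j\neq 0\}$. For every $n$ let $y=X\beta^*+\varepsilon$ with a deterministic design matrix $X=X_n\in\mathbb{R}^{n\times p}$ with rows $x_1,\dots,x_n$ and noise $\varepsilon=\varepsilon_n\in\mathbb{R}^n$ with i.i.d. $\mathcal N(0,\sigma^2)$ entries, and assume that, as $n\to\infty$, $\frac1n X^\top X\to C$ for a positive definite matrix $C$ and $\frac1n\max_i\|x_i\|_2^2\to 0$. Let $m=m_n$ be integers, positive for all large $n$, with $n/m\to r_0\in[0,\infty)$, and let $\tilde\beta=\tilde\beta_n$ be an $\mathbb{R}^p$-valued random vector (the initial estimator), independent of $\varepsilon_n$, such that $\sqrt m(\tilde\beta-\beta^*)$ converges in distribution to some random vector $z$. Let $\gamma_1,\gamma_2\ge 0$, $\lambda_n,\eta_n\ge 0$, and let the Adaptive Transfer Lasso estimator $\hat\beta=\hat\beta_n$ be a random vector that almost surely minimizes over $\beta\in\mathbb{R}^p$ $$\frac1n\|y-X\beta\|_2^2+\frac{\lambda_n}{n}\sum_j\frac{|\beta_j|}{|\tilde\beta_j|^{\gamma_1}}+\frac{\eta_n}{n}\sum_j|\tilde\beta_j|^{\gamma_2}\,|\beta_j-\tilde\beta_j|,$$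 where $0^0=1$ and, if $\gamma_1>0$, $1/0^{\gamma_1}=\infty$ with $0\cdot\infty=0$ (so, when $\lambda_n>0$, a coordinate with $\tilde\beta_j=0$ is forced to be $0$). Put $\hat S=\{j:\hat\beta_j\ne 0\}$. Suppose that, as $n\to\infty$, $$\sqrt{m^{\gamma_1}/n}\;\lambda_n\to\infty,\qquad \frac{\eta_n}{\sqrt n}\to\infty,\qquad \frac{\eta_n}{\lambda_n}\to\infty,\qquad \frac{\eta_n}{\sqrt{m^{\gamma_1+\gamma_2}}\,\lambda_n}\to 0 .$$ Then the following three properties hold: 1. ($\sqrt m$-consistency) $\sqrt m(\hat\beta-\beta^*)$ converges in distribution, namely to the random vector whose $j$-th coordinate is $z_j$ for $j\in S$ and $0$ for $j\notin S$; 2. (consistent active variable selection) $P(\hat S=S)\to 1$; 3. (consistent invariant variable selection) $P(\hat\beta_S=\tilde\beta_S)\to 1$. -/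

import Mathlib

open MeasureTheory ProbabilityTheory Filter Topology
open scoped ENNReal NNReal Matrix

/-- Response vector `y = X β + e` of the linear model with `n` observations and `p` regressors. -/
def linearResponse {n p : ℕ} (X : Matrix (Fin n) (Fin p) ℝ) (β : Fin p → ℝ) (e : Fin n → ℝ) :
    Fin n → ℝ :=
  X *ᵥ β + e

/-- Objective function of the Adaptive Transfer Lasso with initial estimate `b` (playing the role
of `β̃`), at the candidate `β`:
`(1/n) ‖y - Xβ‖₂² + (lam/n) ∑ⱼ vⱼ |βⱼ| + (eta/n) ∑ⱼ wⱼ |βⱼ - bⱼ|`,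
where `vⱼ = 1 / |bⱼ|^γ₁` and `wⱼ = |bⱼ|^γ₂`.
It takes values in `[0, ∞]`: if `bⱼ = 0` and `γ₁ > 0`, then `vⱼ = ∞`, and (as `∞ * 0 = 0`) an
infinite weight forces `βⱼ = 0` as soon as `lam > 0`. Powers with exponent `0` are `1`. -/
noncomputable def adaptiveTransferLassoObjective {n p : ℕ} (X : Matrix (Fin n) (Fin p) ℝ)
    (y : Fin n → ℝ) (lam eta γ₁ γ₂ : ℝ) (b β : Fin p → ℝ) : ℝ≥0∞ :=
  ENNReal.ofReal ((1 / n) * ∑ i, (y i - (X *ᵥ β) i) ^ 2)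
    + ENNReal.ofReal (lam / n) *
        ∑ j, (1 / ENNReal.ofReal |b j| ^ γ₁) * ENNReal.ofReal |β j|
    + ENNReal.ofReal (eta / n) *
        ∑ j, ENNReal.ofReal |b j| ^ γ₂ * ENNReal.ofReal |β j - b j|

/-- `β` is an Adaptive Transfer Lasso estimate, i.e. a global minimizer of the objective. -/
def IsAdaptiveTransferLasso {n p : ℕ} (X : Matrix (Fin n) (Fin p) ℝ)
    (y : Fin n → ℝ) (lam eta γ₁ γ₂ : ℝ) (b β : Fin p → ℝ) : Prop :=
  ∀ β' : Fin p → ℝ, adaptiveTransferLassoObjective X y lam eta γ₁ γ₂ b β ≤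
    adaptiveTransferLassoObjective X y lam eta γ₁ γ₂ b β'

/-!
Write `S` for the support of `βstar`. Expanding the squares at the candidate `S.indicator βtilde`
and dropping the quadratic remainder bounds the residual sum of squares from below by a linear
function whose slope is the score there. So this candidate is the unique minimizer as soon as

* on `S`, the transfer weight `eta * |βtilde j| ^ γ₂` exceeds the adaptive weight
  `lam / |βtilde j| ^ γ₁` plus twice the score;
* off `S`, the adaptive weight exceeds the transfer weight plus twice the score.

When `√m • (βtilde - βstar)` and the normalized noise score are bounded in probability, the score at
the candidate is of order `√n`, because `n = O(m)`. On `S`, where `βtilde j` stays away from `0`,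
the weights are of exact orders `eta` and `lam`. Off `S`, where `βtilde j = O(1 / √m)`, the adaptive
weight is at least of order `√m ^ γ₁ * lam`, the transfer weight at most of order `eta / √m ^ γ₂`.
The four limit relations on `lam` and `eta` compare precisely these orders, so with probability
tending to one the estimator equals `βtilde` on `S` and `0` off `S`.
-/

section PenalizedLeastSquares

variable {ι κ : Type*} [Fintype ι] [Fintype κ]

/-- Least squares with a Lasso penalty of weights `v` and a transfer penalty of weights `w` towards
`b`. Up to the factor `n`, this is the real-valued form of `adaptiveTransferLassoObjective`, valid
at the candidates where the latter is finite. -/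
def weightedTransferObjective (X : Matrix ι κ ℝ) (y : ι → ℝ) (v w b β : κ → ℝ) : ℝ :=
  ∑ i, (y i - (X *ᵥ β) i) ^ 2 + ∑ j, (v j * |β j| + w j * |β j - b j|)

lemma sum_sq_residual_sub_le (X : Matrix ι κ ℝ) (y : ι → ℝ) (c β : κ → ℝ) :
    ∑ i, (y i - (X *ᵥ c) i) ^ 2 - ∑ j, 2 * |(Xᵀ *ᵥ (y - X *ᵥ c)) j| * |β j - c j| ≤
      ∑ i, (y i - (X *ᵥ β) i) ^ 2 := by
  have hcross : ∑ i, (y i - (X *ᵥ c) i) * (X *ᵥ (β - c)) i =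
      ∑ j, (Xᵀ *ᵥ (y - X *ᵥ c)) j * (β j - c j) := by
    rw [Matrix.mulVec_transpose]
    exact Matrix.dotProduct_mulVec (y - X *ᵥ c) X (β - c)
  have hexpand : ∑ i, (y i - (X *ᵥ β) i) ^ 2 = ∑ i, (y i - (X *ᵥ c) i) ^ 2 -
      2 * ∑ i, (y i - (X *ᵥ c) i) * (X *ᵥ (β - c)) i + ∑ i, (X *ᵥ (β - c)) i ^ 2 := by
    rw [Finset.mul_sum, ← Finset.sum_sub_distrib, ← Finset.sum_add_distrib]
    refine Finset.sum_congr rfl fun i _ => ?_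
    rw [Matrix.mulVec_sub, Pi.sub_apply]
    ring
  have hcross_le : ∑ j, (Xᵀ *ᵥ (y - X *ᵥ c)) j * (β j - c j) ≤
      ∑ j, |(Xᵀ *ᵥ (y - X *ᵥ c)) j| * |β j - c j| :=
    Finset.sum_le_sum fun j _ => (le_abs_self _).trans_eq (abs_mul _ _)
  have hsq : 0 ≤ ∑ i, (X *ᵥ (β - c)) i ^ 2 := Finset.sum_nonneg fun _ _ => sq_nonneg _
  rw [hexpand, hcross]
  simp only [mul_assoc, ← Finset.mul_sum]
  linarith

lemma penalty_lt_of_transfer_weight_dominates {v w g b x : ℝ} (hv : 0 ≤ v) (h : g + v < w)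
    (hx : x ≠ b) : g * |x - b| + v * |b| < v * |x| + w * |x - b| := by
  have hpos : 0 < |x - b| := abs_pos.2 (sub_ne_zero.2 hx)
  have htri : |b| ≤ |x| + |x - b| := by simpa using abs_sub x (x - b)
  nlinarith [mul_le_mul_of_nonneg_left htri hv, mul_lt_mul_of_pos_right h hpos]

lemma penalty_lt_of_adaptive_weight_dominates {v w g b x : ℝ} (hw : 0 ≤ w) (h : g + w < v)
    (hx : x ≠ 0) : g * |x| + w * |b| < v * |x| + w * |x - b| := by
  have hpos : 0 < |x| := abs_pos.2 hx
  have htri : |b| ≤ |x| + |x - b| := by simpa using abs_sub x (x - b)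
  nlinarith [mul_le_mul_of_nonneg_left htri hw, mul_lt_mul_of_pos_right h hpos]

theorem eq_indicator_of_weightedTransferObjective_le {X : Matrix ι κ ℝ} {y : ι → ℝ}
    {v w b β : κ → ℝ} {S : Set κ} (hv : 0 ≤ v) (hw : 0 ≤ w)
    (hβ : weightedTransferObjective X y v w b β ≤
      weightedTransferObjective X y v w b (S.indicator b))
    (hS : ∀ j ∈ S, 2 * |(Xᵀ *ᵥ (y - X *ᵥ S.indicator b)) j| + v j < w j)
    (hSc : ∀ j ∉ S, β j ≠ 0 → 2 * |(Xᵀ *ᵥ (y - X *ᵥ S.indicator b)) j| + w j < v j) :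
    β = S.indicator b := by
  set c := S.indicator b with hc
  set g : κ → ℝ := Xᵀ *ᵥ (y - X *ᵥ c)
  have hpenalty : ∀ j, β j ≠ c j → 2 * |g j| * |β j - c j| + (v j * |c j| + w j * |c j - b j|) <
      v j * |β j| + w j * |β j - b j| := fun j hj => by
    by_cases hjS : j ∈ S
    · rw [hc, Set.indicator_of_mem hjS] at hj ⊢
      simpa using penalty_lt_of_transfer_weight_dominates (hv j) (hS j hjS) hj
    · rw [hc, Set.indicator_of_notMem hjS] at hj ⊢
      simpa using penalty_lt_of_adaptive_weight_dominates (b := b j) (hw j) (hSc j hjS hj) hj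
  by_contra hne
  obtain ⟨k, hk⟩ := Function.ne_iff.1 hne
  have hsum : ∑ j, (2 * |g j| * |β j - c j| + (v j * |c j| + w j * |c j - b j|)) <
      ∑ j, (v j * |β j| + w j * |β j - b j|) := by
    refine Finset.sum_lt_sum (fun j _ => ?_) ⟨k, Finset.mem_univ k, hpenalty k hk⟩
    rcases eq_or_ne (β j) (c j) with hj | hj
    · simp [hj]
    · exact (hpenalty j hj).le
  rw [Finset.sum_add_distrib] at hsum
  have hresidual := sum_sq_residual_sub_le X y c β
  unfold weightedTransferObjective at hβ
  linarith

end PenalizedLeastSquares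

section Minimizer

variable {n p : ℕ} {X : Matrix (Fin n) (Fin p) ℝ} {y : Fin n → ℝ} {lam eta γ₁ γ₂ : ℝ}
  {b β : Fin p → ℝ}

lemma one_div_ofReal_rpow_mul_ofReal {γ s x : ℝ} (hγ : 0 ≤ γ) (h : s = 0 → γ ≠ 0 → x = 0) :
    (1 / ENNReal.ofReal |s| ^ γ) * ENNReal.ofReal |x| =
      ENNReal.ofReal ((|s| ^ γ)⁻¹ * |x|) := by
  rcases eq_or_ne x 0 with rfl | hx
  · simp
  have hpos : 0 < |s| ^ γ := by
    rcases eq_or_ne γ 0 with rfl | hγ0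
    · simp
    · exact Real.rpow_pos_of_pos (abs_pos.2 fun hs => hx (h hs hγ0)) _
  rw [ENNReal.ofReal_rpow_of_nonneg (abs_nonneg _) hγ, ENNReal.ofReal_mul (by positivity),
    ENNReal.ofReal_inv_of_pos hpos, one_div]

lemma adaptiveTransferLassoObjective_eq_ofReal (hlam : 0 ≤ lam) (heta : 0 ≤ eta)
    (hγ₁ : 0 ≤ γ₁) (hγ₂ : 0 ≤ γ₂) (h : ∀ j, b j = 0 → γ₁ ≠ 0 → β j = 0) :
    adaptiveTransferLassoObjective X y lam eta γ₁ γ₂ b β =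
      ENNReal.ofReal ((1 / n) * weightedTransferObjective X y
        (fun j => lam * (|b j| ^ γ₁)⁻¹) (fun j => eta * |b j| ^ γ₂) b β) := by
  have hadaptive : ∀ j, (1 / ENNReal.ofReal |b j| ^ γ₁) * ENNReal.ofReal |β j| =
      ENNReal.ofReal ((|b j| ^ γ₁)⁻¹ * |β j|) := fun j =>
    one_div_ofReal_rpow_mul_ofReal hγ₁ (h j)
  have htransfer : ∀ j, ENNReal.ofReal |b j| ^ γ₂ * ENNReal.ofReal |β j - b j| =
      ENNReal.ofReal (|b j| ^ γ₂ * |β j - b j|) := fun j => by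
    rw [ENNReal.ofReal_rpow_of_nonneg (abs_nonneg _) hγ₂, ENNReal.ofReal_mul (by positivity)]
  unfold adaptiveTransferLassoObjective weightedTransferObjective
  simp_rw [hadaptive, htransfer]
  rw [← ENNReal.ofReal_sum_of_nonneg (fun _ _ => by positivity),
    ← ENNReal.ofReal_sum_of_nonneg (fun _ _ => by positivity),
    ← ENNReal.ofReal_mul (by positivity), ← ENNReal.ofReal_mul (by positivity),
    ← ENNReal.ofReal_add (by positivity) (by positivity),
    ← ENNReal.ofReal_add (by positivity) (by positivity), Finset.sum_add_distrib]
  simp only [mul_assoc, ← Finset.mul_sum]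
  ring_nf

lemma adaptiveTransferLassoObjective_eq_top (hn : 0 < n) (hlam : 0 < lam) (hγ₁ : 0 < γ₁)
    {j : Fin p} (hb : b j = 0) (hβ : β j ≠ 0) :
    adaptiveTransferLassoObjective X y lam eta γ₁ γ₂ b β = ⊤ := by
  have hterm : (1 / ENNReal.ofReal |b j| ^ γ₁) * ENNReal.ofReal |β j| = ⊤ := by
    simp [hb, hγ₁, ENNReal.top_mul, hβ]
  have hsum : ∑ k, (1 / ENNReal.ofReal |b k| ^ γ₁) * ENNReal.ofReal |β k| = ⊤ :=
    ENNReal.sum_eq_top.2 ⟨j, Finset.mem_univ j, hterm⟩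
  have hcoef : ENNReal.ofReal (lam / n) ≠ 0 := by
    have : (0 : ℝ) < n := mod_cast hn
    simpa using div_pos hlam this
  rw [adaptiveTransferLassoObjective, hsum, ENNReal.mul_top hcoef, add_top, top_add]

namespace IsAdaptiveTransferLasso

lemma apply_eq_zero (h : IsAdaptiveTransferLasso X y lam eta γ₁ γ₂ b β) (hn : 0 < n)
    (hlam : 0 < lam) (heta : 0 ≤ eta) (hγ₁ : 0 ≤ γ₁) (hγ₂ : 0 ≤ γ₂)
    {j : Fin p} (hb : b j = 0) (hγ : γ₁ ≠ 0) : β j = 0 := by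
  by_contra hβ
  have hle := h 0
  rw [adaptiveTransferLassoObjective_eq_top hn hlam (hγ₁.lt_of_ne' hγ) hb hβ,
    adaptiveTransferLassoObjective_eq_ofReal (β := 0) hlam.le heta hγ₁ hγ₂ fun _ _ _ => rfl] at hle
  exact ENNReal.ofReal_ne_top (top_le_iff.1 hle)

lemma weightedTransferObjective_le (h : IsAdaptiveTransferLasso X y lam eta γ₁ γ₂ b β)
    (hn : 0 < n) (hlam : 0 < lam) (heta : 0 ≤ eta) (hγ₁ : 0 ≤ γ₁) (hγ₂ : 0 ≤ γ₂)
    {c : Fin p → ℝ} (hc : ∀ j, b j = 0 → γ₁ ≠ 0 → c j = 0) :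
    weightedTransferObjective X y
        (fun j => lam * (|b j| ^ γ₁)⁻¹) (fun j => eta * |b j| ^ γ₂) b β ≤
      weightedTransferObjective X y
        (fun j => lam * (|b j| ^ γ₁)⁻¹) (fun j => eta * |b j| ^ γ₂) b c := by
  have hle := h c
  rw [adaptiveTransferLassoObjective_eq_ofReal hlam.le heta hγ₁ hγ₂ hc,
    adaptiveTransferLassoObjective_eq_ofReal hlam.le heta hγ₁ hγ₂
      fun _ => h.apply_eq_zero hn hlam heta hγ₁ hγ₂,
    ENNReal.ofReal_le_ofReal_iff (by unfold weightedTransferObjective; positivity)] at hle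
  exact le_of_mul_le_mul_left hle (by positivity)

/-- The case excluded in `hSc` is that of an infinite adaptive weight, for which the real number
`(|b j| ^ γ₁)⁻¹` is the junk value `0`. -/
theorem eq_indicator (h : IsAdaptiveTransferLasso X y lam eta γ₁ γ₂ b β) (hn : 0 < n)
    (hlam : 0 < lam) (heta : 0 ≤ eta) (hγ₁ : 0 ≤ γ₁) (hγ₂ : 0 ≤ γ₂) {S : Set (Fin p)}
    (hS : ∀ j ∈ S, 2 * |(Xᵀ *ᵥ (y - X *ᵥ S.indicator b)) j| + lam * (|b j| ^ γ₁)⁻¹ <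
      eta * |b j| ^ γ₂)
    (hSc : ∀ j ∉ S, (b j = 0 → γ₁ = 0) →
      2 * |(Xᵀ *ᵥ (y - X *ᵥ S.indicator b)) j| + eta * |b j| ^ γ₂ < lam * (|b j| ^ γ₁)⁻¹) :
    β = S.indicator b := by
  have hadmissible : ∀ j, b j = 0 → γ₁ ≠ 0 → S.indicator b j = 0 := fun j hb _ =>
    Set.indicator_apply_eq_zero.2 fun _ => hb
  refine eq_indicator_of_weightedTransferObjective_le (fun _ => by positivity)
    (fun _ => by positivity)
    (h.weightedTransferObjective_le hn hlam heta hγ₁ hγ₂ hadmissible) hS fun j hj hβ => ?_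
  exact hSc j hj fun hb => of_not_not fun hγ =>
    hβ (h.apply_eq_zero hn hlam heta hγ₁ hγ₂ hb hγ)

end IsAdaptiveTransferLasso

end Minimizer

section Score

variable {ι κ : Type*} [Fintype ι]

lemma abs_transpose_mul_self_apply_le {X : Matrix ι κ ℝ} {G : ℝ}
    (hX : ∀ j, ∑ i, X i j ^ 2 ≤ G) (j k : κ) : |(Xᵀ * X) j k| ≤ G := by
  have hcauchy := Finset.sum_mul_sq_le_sq_mul_sq Finset.univ (fun i => X i j) (fun i => X i k)
  have hG : 0 ≤ G := (Finset.sum_nonneg fun i _ => sq_nonneg (X i j)).trans (hX j)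
  refine abs_le_of_sq_le_sq (hcauchy.trans ?_) hG
  rw [sq G]
  exact mul_le_mul (hX j) (hX k) (Finset.sum_nonneg fun i _ => sq_nonneg _) hG

variable [Fintype κ]

lemma norm_transpose_mul_self_mulVec_le {X : Matrix ι κ ℝ} {G : ℝ} (hG : 0 ≤ G)
    (hX : ∀ j, ∑ i, X i j ^ 2 ≤ G) (d : κ → ℝ) :
    ‖(Xᵀ * X) *ᵥ d‖ ≤ Fintype.card κ * G * ‖d‖ := by
  refine (pi_norm_le_iff_of_nonneg (by positivity)).2 fun j => ?_
  calc ‖((Xᵀ * X) *ᵥ d) j‖ ≤ ∑ k, ‖(Xᵀ * X) j k * d k‖ := norm_sum_le _ _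
    _ ≤ ∑ _k : κ, G * ‖d‖ := Finset.sum_le_sum fun k _ => by
        rw [norm_mul]
        exact mul_le_mul (abs_transpose_mul_self_apply_le hX j k) (norm_le_pi_norm d k)
          (norm_nonneg _) hG
    _ = Fintype.card κ * G * ‖d‖ := by
        rw [Finset.sum_const, Finset.card_univ, nsmul_eq_mul, mul_assoc]

lemma norm_score_le {X : Matrix ι κ ℝ} {G R K s t : ℝ} (hG : 0 ≤ G) (hs : 0 < s) (ht : 0 < t)
    (hst : s ≤ R * t) (hX : ∀ j, ∑ i, X i j ^ 2 ≤ G * s ^ 2) {e : ι → ℝ} {d : κ → ℝ}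
    (he : ‖s⁻¹ • (Xᵀ *ᵥ e)‖ ≤ K) (hd : ‖t • d‖ ≤ K) :
    ‖Xᵀ *ᵥ (e - X *ᵥ d)‖ ≤ (1 + Fintype.card κ * G * R) * K * s := by
  rw [norm_smul, norm_inv, Real.norm_of_nonneg hs.le, inv_mul_le_iff₀ hs] at he
  rw [norm_smul, Real.norm_of_nonneg ht.le] at hd
  have hsd : s * ‖d‖ ≤ R * K := by
    have hR : 0 ≤ R := nonneg_of_mul_nonneg_left (hs.le.trans hst) ht
    calc s * ‖d‖ ≤ R * t * ‖d‖ := by gcongr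
      _ = R * (t * ‖d‖) := mul_assoc _ _ _
      _ ≤ R * K := by gcongr
  calc ‖Xᵀ *ᵥ (e - X *ᵥ d)‖ = ‖Xᵀ *ᵥ e - (Xᵀ * X) *ᵥ d‖ := by
        rw [Matrix.mulVec_sub, Matrix.mulVec_mulVec]
    _ ≤ ‖Xᵀ *ᵥ e‖ + ‖(Xᵀ * X) *ᵥ d‖ := norm_sub_le _ _
    _ ≤ s * K + Fintype.card κ * (G * s ^ 2) * ‖d‖ := by
        gcongr
        exact norm_transpose_mul_self_mulVec_le (by positivity) hX d
    _ = s * K + Fintype.card κ * G * s * (s * ‖d‖) := by ring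
    _ ≤ s * K + Fintype.card κ * G * s * (R * K) := by gcongr
    _ = (1 + Fintype.card κ * G * R) * K * s := by ring

end Score

section WeightDomination

variable {ι : Type*} {l : Filter ι}

lemma eventually_mul_add_mul_lt_mul {a b c : ι → ℝ} (hc : ∀ᶠ i in l, 0 < c i)
    (hac : Tendsto (fun i => a i / c i) l (𝓝 0)) (hbc : Tendsto (fun i => b i / c i) l (𝓝 0))
    (M B : ℝ) {A : ℝ} (hA : 0 < A) : ∀ᶠ i in l, M * a i + B * b i < A * c i := by
  have hlim : Tendsto (fun i => M * (a i / c i) + B * (b i / c i)) l (𝓝 0) := by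
    simpa using (hac.const_mul M).add (hbc.const_mul B)
  filter_upwards [hlim.eventually (gt_mem_nhds hA), hc] with i hi hci
  rwa [← mul_div_assoc, ← mul_div_assoc, ← add_div, div_lt_iff₀ hci] at hi

variable {a lam eta s : ι → ℝ} {γ₁ γ₂ : ℝ}

lemma eventually_transfer_weight_dominates (hγ₁ : 0 ≤ γ₁) (hγ₂ : 0 ≤ γ₂)
    (hlam : ∀ᶠ i in l, 0 < lam i) (heta : ∀ᶠ i in l, 0 < eta i)
    (h₁ : Tendsto (fun i => eta i / a i) l atTop)
    (h₂ : Tendsto (fun i => eta i / lam i) l atTop) {r : ℝ} (hr : 0 < r) (M : ℝ) :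
    ∀ᶠ i in l, ∀ x : ℝ, r ≤ |x| → M * a i + lam i * (|x| ^ γ₁)⁻¹ < eta i * |x| ^ γ₂ := by
  have hae : Tendsto (fun i => a i / eta i) l (𝓝 0) :=
    h₁.inv_tendsto_atTop.congr fun i => inv_div _ _
  have hle : Tendsto (fun i => lam i / eta i) l (𝓝 0) :=
    h₂.inv_tendsto_atTop.congr fun i => inv_div _ _
  filter_upwards [hlam, heta, eventually_mul_add_mul_lt_mul heta hae hle M (r ^ γ₁)⁻¹
    (Real.rpow_pos_of_pos hr γ₂)] with i hlami hetai hi x hx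
  calc M * a i + lam i * (|x| ^ γ₁)⁻¹ ≤ M * a i + (r ^ γ₁)⁻¹ * lam i := by
        rw [mul_comm (lam i)]
        gcongr
    _ < r ^ γ₂ * eta i := hi
    _ ≤ eta i * |x| ^ γ₂ := by
        rw [mul_comm]
        gcongr

lemma eventually_adaptive_weight_dominates (hs : ∀ᶠ i in l, 0 < s i)
    (hγ₁ : 0 ≤ γ₁) (hγ₂ : 0 ≤ γ₂) (hlam : ∀ᶠ i in l, 0 < lam i) (heta : ∀ᶠ i in l, 0 < eta i)
    (h₁ : Tendsto (fun i => s i ^ γ₁ * lam i / a i) l atTop)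
    (h₂ : Tendsto (fun i => eta i / (s i ^ (γ₁ + γ₂) * lam i)) l (𝓝 0))
    {K : ℝ} (hK : 0 < K) (M : ℝ) :
    ∀ᶠ i in l, ∀ x : ℝ, |x| ≤ K / s i → (x = 0 → γ₁ = 0) →
      M * a i + eta i * |x| ^ γ₂ < lam i * (|x| ^ γ₁)⁻¹ := by
  have hscaled : ∀ᶠ i in l, 0 < s i ^ γ₁ * lam i := by
    filter_upwards [hs, hlam] with i hsi hlami
    positivity
  have hal : Tendsto (fun i => a i / (s i ^ γ₁ * lam i)) l (𝓝 0) :=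
    h₁.inv_tendsto_atTop.congr fun i => inv_div _ _
  have hel : Tendsto (fun i => eta i / s i ^ γ₂ / (s i ^ γ₁ * lam i)) l (𝓝 0) := by
    refine h₂.congr' (hs.mono fun i hsi => ?_)
    simp only [Real.rpow_add hsi, div_div]
    ring_nf
  filter_upwards [hs, hlam, heta, eventually_mul_add_mul_lt_mul hscaled hal hel M (K ^ γ₂)
    (inv_pos.2 (Real.rpow_pos_of_pos hK γ₁))] with i hsi hlami hetai hi x hx hx0
  have hxpos : 0 < |x| ^ γ₁ := by
    rcases eq_or_ne x 0 with rfl | hne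
    · simp [hx0 rfl]
    · exact Real.rpow_pos_of_pos (abs_pos.2 hne) _
  calc M * a i + eta i * |x| ^ γ₂ ≤ M * a i + eta i * (K / s i) ^ γ₂ := by gcongr
    _ = M * a i + K ^ γ₂ * (eta i / s i ^ γ₂) := by rw [Real.div_rpow hK.le hsi.le]; ring
    _ < (K ^ γ₁)⁻¹ * (s i ^ γ₁ * lam i) := hi
    _ = lam i * ((K / s i) ^ γ₁)⁻¹ := by rw [Real.div_rpow hK.le hsi.le, inv_div]; ring
    _ ≤ lam i * (|x| ^ γ₁)⁻¹ := by gcongr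

variable {κ : Type*} [Fintype κ]

lemma abs_apply_sub_le_div {t K : ℝ} {b b₀ : κ → ℝ} (ht : 0 < t)
    (h : ‖t • (b - b₀)‖ ≤ K) (j : κ) : |b j - b₀ j| ≤ K / t := by
  rw [norm_smul, Real.norm_of_nonneg ht.le] at h
  exact (norm_le_pi_norm (b - b₀) j).trans ((le_div_iff₀' ht).2 h)

lemma eventually_half_abs_le_abs (hs : Tendsto s l atTop) {b₀ : κ → ℝ} {j : κ}
    (hj : b₀ j ≠ 0) (K : ℝ) :
    ∀ᶠ i in l, ∀ b, ‖s i • (b - b₀)‖ ≤ K → |b₀ j| / 2 ≤ |b j| := by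
  have hsmall : ∀ᶠ i in l, K / s i < |b₀ j| / 2 :=
    (hs.const_div_atTop K).eventually_lt_const (by positivity)
  filter_upwards [hsmall, hs.eventually_gt_atTop 0] with i hi hsi b hb
  have hclose := abs_apply_sub_le_div hsi hb j
  have htri : |b₀ j| - |b j| ≤ |b j - b₀ j| := by
    rw [abs_sub_comm]
    exact abs_sub_abs_le_abs_sub _ _
  linarith

lemma eventually_transfer_weight_dominates_support (hs : Tendsto s l atTop)
    (hγ₁ : 0 ≤ γ₁) (hγ₂ : 0 ≤ γ₂) (hlam : ∀ᶠ i in l, 0 < lam i) (heta : ∀ᶠ i in l, 0 < eta i)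
    (h₁ : Tendsto (fun i => eta i / a i) l atTop)
    (h₂ : Tendsto (fun i => eta i / lam i) l atTop) (b₀ : κ → ℝ) (K M : ℝ) :
    ∀ᶠ i in l, ∀ b, ‖s i • (b - b₀)‖ ≤ K → ∀ j ∈ Function.support b₀,
      b j ≠ 0 ∧ M * a i + lam i * (|b j| ^ γ₁)⁻¹ < eta i * |b j| ^ γ₂ := by
  have hcoord : ∀ j, ∀ᶠ i in l, b₀ j ≠ 0 → ∀ b, ‖s i • (b - b₀)‖ ≤ K →
      b j ≠ 0 ∧ M * a i + lam i * (|b j| ^ γ₁)⁻¹ < eta i * |b j| ^ γ₂ := fun j => by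
    refine eventually_imp_distrib_left.2 fun hj => ?_
    have hr : 0 < |b₀ j| / 2 := by positivity
    filter_upwards [eventually_half_abs_le_abs hs hj K,
      eventually_transfer_weight_dominates hγ₁ hγ₂ hlam heta h₁ h₂ hr M] with i hfar hdom b hb
    exact ⟨abs_pos.1 (hr.trans_le (hfar b hb)), hdom (b j) (hfar b hb)⟩
  filter_upwards [eventually_all.2 hcoord] with i hi b hb j hj using hi j hj b hb

lemma eventually_adaptive_weight_dominates_compl_support (hs : Tendsto s l atTop)
    (hγ₁ : 0 ≤ γ₁) (hγ₂ : 0 ≤ γ₂) (hlam : ∀ᶠ i in l, 0 < lam i) (heta : ∀ᶠ i in l, 0 < eta i)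
    (h₁ : Tendsto (fun i => s i ^ γ₁ * lam i / a i) l atTop)
    (h₂ : Tendsto (fun i => eta i / (s i ^ (γ₁ + γ₂) * lam i)) l (𝓝 0))
    (b₀ : κ → ℝ) {K : ℝ} (hK : 0 < K) (M : ℝ) :
    ∀ᶠ i in l, ∀ b, ‖s i • (b - b₀)‖ ≤ K → ∀ j ∉ Function.support b₀, (b j = 0 → γ₁ = 0) →
      M * a i + eta i * |b j| ^ γ₂ < lam i * (|b j| ^ γ₁)⁻¹ := by
  have hspos := hs.eventually_gt_atTop 0
  filter_upwards [hspos, eventually_adaptive_weight_dominates hspos hγ₁ hγ₂ hlam heta h₁ h₂ hK M]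
    with i hsi hdom b hb j hj hbj
  have hclose : |b j| ≤ K / s i := by
    simpa [Function.notMem_support.1 hj] using abs_apply_sub_le_div hsi hb j
  exact hdom (b j) hclose hbj

end WeightDomination

section Indicator

variable {κ E : Type*}

lemma norm_indicator_le_norm_pi [Fintype κ] [SeminormedAddCommGroup E] (S : Set κ) (d : κ → E) :
    ‖S.indicator d‖ ≤ ‖d‖ :=
  (pi_norm_le_iff_of_nonneg (norm_nonneg d)).2 fun j =>
    (norm_indicator_le_norm_self d j).trans (norm_le_pi_norm d j)

lemma continuous_indicator_pi [TopologicalSpace E] [Zero E] (S : Set κ) :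
    Continuous fun d : κ → E => S.indicator d := by
  refine continuous_pi fun j => ?_
  by_cases hj : j ∈ S
  · simpa only [Set.indicator_of_mem hj] using continuous_apply j
  · simpa only [Set.indicator_of_notMem hj] using continuous_const

variable [AddGroup E]

lemma indicator_support_sub_self (b b₀ : κ → E) :
    (Function.support b₀).indicator b - b₀ = (Function.support b₀).indicator (b - b₀) := by
  rw [Set.indicator_sub', Set.indicator_support]

lemma smul_sub_eq_indicator_of_support_eq {M : Type*} [Monoid M] [DistribMulAction M E]
    {β b b₀ : κ → E} (hsupp : Function.support β = Function.support b₀)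
    (hagree : ∀ j ∈ Function.support b₀, β j = b j) (t : M) :
    t • (β - b₀) = (Function.support b₀).indicator (t • (b - b₀)) := by
  have hβ : β = (Function.support b₀).indicator b := by
    rw [← Set.indicator_congr hagree, ← hsupp, Set.indicator_support]
  rw [hβ, indicator_support_sub_self]
  exact (Set.indicator_const_smul _ t (b - b₀)).symm

end Indicator

section AsymptoticOracle

variable {p : ℕ} {X : (n : ℕ) → Matrix (Fin n) (Fin p) ℝ} {m lam eta : ℕ → ℝ} {γ₁ γ₂ : ℝ}

lemma linearResponse_sub_mulVec {n : ℕ} (X : Matrix (Fin n) (Fin p) ℝ) (b₀ c : Fin p → ℝ)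
    (e : Fin n → ℝ) : linearResponse X b₀ e - X *ᵥ c = e - X *ᵥ (c - b₀) := by
  rw [linearResponse, Matrix.mulVec_sub]
  abel

lemma eventually_norm_score_indicator_le (hm : ∀ᶠ n in atTop, 0 < m n)
    (hnm : (fun n : ℕ => (n : ℝ)) =O[atTop] m)
    (hX : ∀ j, (fun n => ∑ i, X n i j ^ 2) =O[atTop] fun n : ℕ => (n : ℝ))
    (b₀ : Fin p → ℝ) (K : ℝ) :
    ∃ M, ∀ᶠ n : ℕ in atTop, ∀ e b, ‖√(m n) • (b - b₀)‖ ≤ K →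
      ‖(√n)⁻¹ • ((X n)ᵀ *ᵥ e)‖ ≤ K →
      ‖(X n)ᵀ *ᵥ (linearResponse (X n) b₀ e - X n *ᵥ (Function.support b₀).indicator b)‖ ≤
        M * √n := by
  obtain ⟨R, hR⟩ := hnm.bound
  obtain ⟨G, hG, hGX⟩ : ∃ G : ℝ, 0 ≤ G ∧
      ∀ᶠ n : ℕ in atTop, ∀ j, ∑ i, X n i j ^ 2 ≤ G * √n ^ 2 := by
    choose G hG hGX using fun j => (hX j).exists_nonneg
    refine ⟨∑ j, G j, Finset.sum_nonneg fun j _ => hG j, eventually_all.2 fun j => ?_⟩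
    filter_upwards [(hGX j).bound] with n hn
    rw [Real.sq_sqrt n.cast_nonneg]
    calc ∑ i, X n i j ^ 2 ≤ G j * n := by simpa using (le_abs_self _).trans hn
      _ ≤ (∑ k, G k) * n := by
        gcongr
        exact Finset.single_le_sum (fun k _ => hG k) (Finset.mem_univ j)
  refine ⟨(1 + Fintype.card (Fin p) * G * √R) * K, ?_⟩
  filter_upwards [hR, hGX, hm, eventually_gt_atTop 0] with n hRn hGn hmn hn e b hb he
  rw [linearResponse_sub_mulVec, indicator_support_sub_self]
  have hRm : (n : ℝ) ≤ R * m n := by simpa [abs_of_pos hmn] using hRn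
  refine norm_score_le hG (by positivity) (Real.sqrt_pos.2 hmn) ?_ hGn he ?_
  · rw [← Real.sqrt_mul' _ hmn.le]
    exact Real.sqrt_le_sqrt hRm
  · rw [norm_smul] at hb ⊢
    exact (mul_le_mul_of_nonneg_left (norm_indicator_le_norm_pi _ _) (norm_nonneg _)).trans hb

lemma sqrt_rpow_eq_rpow_sqrt {x : ℝ} (hx : 0 ≤ x) (r : ℝ) : √(x ^ r) = √x ^ r := by
  rw [← Real.rpow_div_two_eq_sqrt r hx, Real.sqrt_eq_rpow, ← Real.rpow_mul hx, mul_one_div]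

lemma tendsto_sqrt_atTop_of_isBigO (hm : ∀ᶠ n in atTop, 0 < m n)
    (hnm : (fun n : ℕ => (n : ℝ)) =O[atTop] m) : Tendsto (fun n => √(m n)) atTop atTop := by
  have hnorm : Tendsto (fun n => ‖m n‖) atTop atTop :=
    hnm.trans_tendsto_norm_atTop (tendsto_norm_atTop_atTop.comp tendsto_natCast_atTop_atTop)
  refine Real.tendsto_sqrt_atTop.comp (hnorm.congr' (hm.mono fun n hmn => ?_))
  exact Real.norm_of_nonneg hmn.le

theorem eventually_support_eq_and_apply_eq (hm : ∀ᶠ n in atTop, 0 < m n)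
    (hnm : (fun n : ℕ => (n : ℝ)) =O[atTop] m)
    (hX : ∀ j, (fun n => ∑ i, X n i j ^ 2) =O[atTop] fun n : ℕ => (n : ℝ))
    (hγ₁ : 0 ≤ γ₁) (hγ₂ : 0 ≤ γ₂)
    (h1 : Tendsto (fun n : ℕ => √(m n ^ γ₁ / n) * lam n) atTop atTop)
    (h2 : Tendsto (fun n : ℕ => eta n / √n) atTop atTop)
    (h3 : Tendsto (fun n => eta n / lam n) atTop atTop)
    (h4 : Tendsto (fun n => eta n / (√(m n ^ (γ₁ + γ₂)) * lam n)) atTop (𝓝 0))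
    (b₀ : Fin p → ℝ) {K : ℝ} (hK : 0 < K) :
    ∀ᶠ n : ℕ in atTop, ∀ e b β, ‖√(m n) • (b - b₀)‖ ≤ K → ‖(√n)⁻¹ • ((X n)ᵀ *ᵥ e)‖ ≤ K →
      IsAdaptiveTransferLasso (X n) (linearResponse (X n) b₀ e) (lam n) (eta n) γ₁ γ₂ b β →
      Function.support β = Function.support b₀ ∧ ∀ j ∈ Function.support b₀, β j = b j := by
  have hs := tendsto_sqrt_atTop_of_isBigO hm hnm
  have hlam : ∀ᶠ n in atTop, 0 < lam n :=
    (h1.eventually_gt_atTop 0).mono fun n hn => pos_of_mul_pos_right hn (Real.sqrt_nonneg _)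
  have heta : ∀ᶠ n in atTop, 0 < eta n :=
    (h2.eventually_gt_atTop 0).mono fun n hn =>
      pos_of_mul_pos_left (div_eq_mul_inv (eta n) _ ▸ hn) (by positivity)
  have h1' : Tendsto (fun n : ℕ => √(m n) ^ γ₁ * lam n / √n) atTop atTop :=
    h1.congr' <| hm.mono fun n hmn => by
      rw [Real.sqrt_div (by positivity), sqrt_rpow_eq_rpow_sqrt hmn.le]
      ring
  have h4' : Tendsto (fun n => eta n / (√(m n) ^ (γ₁ + γ₂) * lam n)) atTop (𝓝 0) :=
    h4.congr' <| hm.mono fun n hmn => by simp only [sqrt_rpow_eq_rpow_sqrt hmn.le]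
  obtain ⟨M, hscore⟩ := eventually_norm_score_indicator_le hm hnm hX b₀ K
  filter_upwards [eventually_gt_atTop 0, hlam, heta, hscore,
    eventually_transfer_weight_dominates_support hs hγ₁ hγ₂ hlam heta h2 h3 b₀ K (2 * M),
    eventually_adaptive_weight_dominates_compl_support hs hγ₁ hγ₂ hlam heta h1' h4' b₀ hK (2 * M)]
    with n hn hlamn hetan hscoren hactive hinactive e b β hb he hβ
  have hgrad : ∀ j, 2 * |((X n)ᵀ *ᵥ (linearResponse (X n) b₀ e -
      X n *ᵥ (Function.support b₀).indicator b)) j| ≤ 2 * M * √n := fun j => by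
    rw [mul_assoc]
    gcongr
    exact (norm_le_pi_norm _ j).trans (hscoren e b hb he)
  have hβ_eq : β = (Function.support b₀).indicator b :=
    hβ.eq_indicator hn hlamn hetan.le hγ₁ hγ₂
      (fun j hj => (add_le_add_left (hgrad j) _).trans_lt (hactive b hb j hj).2)
      fun j hj hbj => (add_le_add_left (hgrad j) _).trans_lt (hinactive b hb j hj hbj)
  refine ⟨?_, fun j hj => hβ_eq ▸ Set.indicator_of_mem hj b⟩
  rw [hβ_eq, Set.support_indicator, Set.inter_eq_left]
  exact fun j hj => (hactive b hb j hj).1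

end AsymptoticOracle

section BoundedInProbability

variable {ι Ω E F : Type*} [MeasurableSpace Ω] {P : Measure Ω} {l : Filter ι}

/-- Boundedness in probability along the filter `l`, written `T n = O_P(1)` in statistics: outside
an event of arbitrarily small probability, `T n` is bounded by a constant, eventually in `n`. -/
def IsBoundedInProbability [Norm E] (P : Measure Ω) (l : Filter ι) (T : ι → Ω → E) : Prop :=
  ∀ δ : ℝ≥0∞, 0 < δ → ∃ K : ℝ, ∀ᶠ n in l, P {ω | K < ‖T n ω‖} ≤ δ

namespace IsBoundedInProbability

lemma pi {κ : Type*} [Fintype κ] [SeminormedAddCommGroup E] {T : ι → Ω → κ → E}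
    (hT : ∀ j, IsBoundedInProbability P l fun n ω => T n ω j) : IsBoundedInProbability P l T := by
  intro δ hδ
  choose K hK using fun j => hT j (δ / Fintype.card κ) (ENNReal.div_pos hδ.ne' (by simp))
  refine ⟨∑ j, |K j|, ?_⟩
  filter_upwards [eventually_all.2 hK] with n hn
  have hsub : {ω | ∑ j, |K j| < ‖T n ω‖} ⊆ ⋃ j, {ω | K j < ‖T n ω j‖} := fun ω hω => by
    by_contra hbdd
    simp only [Set.mem_iUnion, Set.mem_ofPred_eq, not_exists, not_lt] at hbdd
    refine not_le.2 hω ((pi_norm_le_iff_of_nonneg (by positivity)).2 fun j => ?_)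
    exact (hbdd j).trans ((le_abs_self _).trans
      (Finset.single_le_sum (fun k _ => abs_nonneg (K k)) (Finset.mem_univ j)))
  calc P {ω | ∑ j, |K j| < ‖T n ω‖} ≤ ∑ j, P {ω | K j < ‖T n ω j‖} :=
        (measure_mono hsub).trans (measure_iUnion_fintype_le _ _)
    _ ≤ ∑ _j : κ, δ / Fintype.card κ := Finset.sum_le_sum fun j _ => hn j
    _ ≤ δ := by
        rw [Finset.sum_const, Finset.card_univ, nsmul_eq_mul]
        exact ENNReal.mul_div_le

lemma prodMk [Norm E] [Norm F] {T : ι → Ω → E} {U : ι → Ω → F}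
    (hT : IsBoundedInProbability P l T) (hU : IsBoundedInProbability P l U) :
    IsBoundedInProbability P l fun n ω => (T n ω, U n ω) := by
  intro δ hδ
  obtain ⟨K, hK⟩ := hT (δ / 2) (ENNReal.half_pos hδ.ne')
  obtain ⟨L, hL⟩ := hU (δ / 2) (ENNReal.half_pos hδ.ne')
  refine ⟨max K L, ?_⟩
  filter_upwards [hK, hL] with n hKn hLn
  have hsub : {ω | max K L < ‖(T n ω, U n ω)‖} ⊆ {ω | K < ‖T n ω‖} ∪ {ω | L < ‖U n ω‖} :=
    fun ω hω => by
      by_contra hbdd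
      simp only [Set.mem_union, Set.mem_ofPred_eq, not_or, not_lt] at hbdd
      exact not_le.2 hω (max_le_max hbdd.1 hbdd.2)
  calc P {ω | max K L < ‖(T n ω, U n ω)‖} ≤ P {ω | K < ‖T n ω‖} + P {ω | L < ‖U n ω‖} :=
        (measure_mono hsub).trans (measure_union_le _ _)
    _ ≤ δ / 2 + δ / 2 := add_le_add hKn hLn
    _ = δ := ENNReal.add_halves δ

lemma tendsto_measure_not [Norm E] {T : ι → Ω → E} (hT : IsBoundedInProbability P l T)
    {q : ι → Ω → Prop} (hq : ∀ K : ℝ, 0 < K → ∀ᶠ n in l, ∀ᵐ ω ∂P, ‖T n ω‖ ≤ K → q n ω) :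
    Tendsto (fun n => P {ω | ¬ q n ω}) l (𝓝 0) := by
  refine ENNReal.tendsto_nhds_zero.2 fun δ hδ => ?_
  obtain ⟨K, hK⟩ := hT δ hδ
  filter_upwards [hK, hq (max K 1) (by positivity)] with n hKn hqn
  refine (measure_mono_ae ?_).trans hKn
  filter_upwards [hqn] with ω hω hnot
  by_contra hle
  exact hnot (hω ((not_lt.1 hle).trans (le_max_left _ _)))

end IsBoundedInProbability

lemma isBoundedInProbability_of_variance_le [IsFiniteMeasure P] {T : ι → Ω → ℝ} {V : ℝ}
    (hT : ∀ n, MemLp (T n) 2 P) (hmean : ∀ n, ∫ ω, T n ω ∂P = 0)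
    (hvar : ∀ᶠ n in l, Var[T n; P] ≤ V) : IsBoundedInProbability P l T := by
  intro δ hδ
  have hlim : Tendsto (fun K : ℝ => ENNReal.ofReal (V / K ^ 2)) atTop (𝓝 0) := by
    rw [← ENNReal.ofReal_zero]
    exact ENNReal.tendsto_ofReal ((tendsto_pow_atTop two_ne_zero).const_div_atTop V)
  obtain ⟨K, hKδ, hK⟩ := ((hlim.eventually_le_const hδ).and (eventually_gt_atTop 0)).exists
  refine ⟨K, hvar.mono fun n hn => ?_⟩
  calc P {ω | K < ‖T n ω‖} ≤ P {ω | K ≤ |T n ω - ∫ ω, T n ω ∂P|} :=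
        measure_mono fun ω hω => by simpa [hmean n] using le_of_lt hω
    _ ≤ ENNReal.ofReal (Var[T n; P] / K ^ 2) := meas_ge_le_variance_div_sq (hT n) hK
    _ ≤ ENNReal.ofReal (V / K ^ 2) := by gcongr
    _ ≤ δ := hKδ

variable [NormedAddCommGroup E] [MeasurableSpace E] [BorelSpace E] {Ω' : Type*}
  [MeasurableSpace Ω'] {P' : Measure Ω'} {T T' : ι → Ω → E} {Z : Ω' → E}
  [IsProbabilityMeasure P] [IsProbabilityMeasure P']

lemma isBoundedInProbability_of_tendstoInDistribution
    [CompleteSpace E] [SecondCountableTopology E]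
    (h : TendstoInDistribution T l Z (fun _ => P) P') : IsBoundedInProbability P l T := by
  intro δ hδ
  have := Measure.isProbabilityMeasure_map h.aemeasurable_limit
  have htight := tendsto_measure_norm_gt_of_isTightMeasureSet
    (isTightMeasureSet_singleton (μ := P'.map Z))
  simp only [Set.mem_singleton_iff, iSup_iSup_eq_left] at htight
  obtain ⟨r, hr⟩ := (htight.eventually_lt_const hδ).exists
  have htail : P'.map Z {x | r + 1 ≤ ‖x‖} < δ :=
    (measure_mono fun x hx => lt_of_lt_of_le (lt_add_one r) hx).trans_lt hr
  have hlimsup := ProbabilityMeasure.limsup_measure_closed_le_of_tendsto h.tendsto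
    (isClosed_le continuous_const continuous_norm : IsClosed {x : E | r + 1 ≤ ‖x‖})
  refine ⟨r + 1, (eventually_lt_of_limsup_lt (hlimsup.trans_lt htail)).mono fun n hn => ?_⟩
  calc P {ω | r + 1 < ‖T n ω‖} ≤ P (T n ⁻¹' {x | r + 1 ≤ ‖x‖}) :=
        measure_mono fun ω (hω : r + 1 < ‖T n ω‖) => hω.le
    _ ≤ P.map (T n) {x | r + 1 ≤ ‖x‖} := Measure.le_map_apply (h.forall_aemeasurable n) _
    _ ≤ δ := hn.le

lemma tendsto_measure_one_of_tendsto_measure_not {q r : ι → Ω → Prop}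
    (hq : Tendsto (fun n => P {ω | ¬ q n ω}) l (𝓝 0)) (hqr : ∀ n ω, q n ω → r n ω) :
    Tendsto (fun n => P {ω | r n ω}) l (𝓝 1) := by
  have hlower : Tendsto (fun n => 1 - P {ω | ¬ q n ω}) l (𝓝 1) := by
    simpa using ENNReal.Tendsto.sub tendsto_const_nhds hq (Or.inl ENNReal.one_ne_top)
  refine tendsto_of_tendsto_of_tendsto_of_le_of_le hlower tendsto_const_nhds (fun n => ?_)
    fun n => prob_le_one
  rw [tsub_le_iff_right, ← measure_univ (μ := P)]
  refine (measure_mono fun ω _ => ?_).trans (measure_union_le _ _)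
  by_cases hω : q n ω
  exacts [Or.inl (hqr n ω hω), Or.inr hω]

lemma tendstoInDistribution_of_tendsto_measure_ne [SecondCountableTopology E]
    [l.IsCountablyGenerated]
    (h : TendstoInDistribution T l Z (fun _ => P) P') (hT' : ∀ n, AEMeasurable (T' n) P)
    (hne : Tendsto (fun n => P {ω | T' n ω ≠ T n ω}) l (𝓝 0)) :
    TendstoInDistribution T' l Z (fun _ => P) P' := by
  refine tendstoInDistribution_of_tendstoInMeasure_sub T' Z h (fun δ hδ => ?_) hT'
  refine tendsto_of_tendsto_of_tendsto_of_le_of_le tendsto_const_nhds hne (fun _ => zero_le)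
    fun n => measure_mono fun ω (hω : δ ≤ edist (T' n ω - T n ω) 0) heq => hδ.not_ge ?_
  rwa [heq, sub_self, edist_self] at hω

end BoundedInProbability

section Noise

variable {Ω : Type*} [MeasurableSpace Ω] {P : Measure Ω} [IsFiniteMeasure P]

lemma variance_sum_mul_of_uncorrelated {ι : Type*} [Fintype ι] {ξ : ι → Ω → ℝ}
    (hξ : ∀ i, MemLp (ξ i) 2 P) (hcov : Pairwise fun i j => cov[ξ i, ξ j; P] = 0) (a : ι → ℝ) :
    Var[fun ω => ∑ i, a i * ξ i ω; P] = ∑ i, a i ^ 2 * Var[ξ i; P] := by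
  rw [variance_fun_sum fun i => (hξ i).const_mul (a i)]
  refine Finset.sum_congr rfl fun i _ => ?_
  rw [Finset.sum_eq_single i (fun j _ hj => ?_) (by simp)]
  · rw [covariance_self ((hξ i).const_mul (a i)).aemeasurable, variance_const_mul]
  · rw [covariance_const_mul_left, covariance_const_mul_right, hcov hj.symm]
    simp

lemma isBoundedInProbability_normalized_score {p : ℕ} {X : (n : ℕ) → Matrix (Fin n) (Fin p) ℝ}
    (hX : ∀ j, (fun n => ∑ i, X n i j ^ 2) =O[atTop] fun n : ℕ => (n : ℝ))
    {ε : (n : ℕ) → Fin n → Ω → ℝ} {v : ℝ≥0} (hε : ∀ n i, MemLp (ε n i) 2 P)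
    (hmean : ∀ n i, ∫ ω, ε n i ω ∂P = 0) (hvar : ∀ n i, Var[ε n i; P] ≤ v)
    (hcov : ∀ n, Pairwise fun i j => cov[ε n i, ε n j; P] = 0) :
    IsBoundedInProbability P atTop fun (n : ℕ) ω => (√n)⁻¹ • ((X n)ᵀ *ᵥ fun i => ε n i ω) := by
  refine .pi fun j => ?_
  obtain ⟨G, hG⟩ := (hX j).bound
  have hcoord : (fun (n : ℕ) ω => ((√n)⁻¹ • ((X n)ᵀ *ᵥ fun i => ε n i ω)) j) =
      fun (n : ℕ) ω => ∑ i, (√n)⁻¹ * X n i j * ε n i ω := by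
    ext n ω
    simp [Matrix.mulVec, dotProduct, Finset.mul_sum, mul_assoc]
  rw [hcoord]
  have hterm : ∀ (n : ℕ) i, MemLp (fun ω => (√n)⁻¹ * X n i j * ε n i ω) 2 P := fun n i =>
    (hε n i).const_mul _
  refine isBoundedInProbability_of_variance_le (V := v * G)
    (fun n => memLp_finsetSum _ fun i _ => hterm n i) (fun n => ?_) ?_
  · rw [integral_finsetSum _ fun i _ => (hterm n i).integrable one_le_two]
    simp [integral_const_mul, hmean]
  · filter_upwards [hG, eventually_gt_atTop 0] with n hGn hn
    have hcol : ∑ i, X n i j ^ 2 ≤ G * n := by simpa using (le_abs_self _).trans hGn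
    calc Var[fun ω => ∑ i, (√n)⁻¹ * X n i j * ε n i ω; P]
        = ∑ i, ((√n)⁻¹ * X n i j) ^ 2 * Var[ε n i; P] :=
          variance_sum_mul_of_uncorrelated (hε n) (hcov n) _
      _ ≤ ∑ i, ((√n)⁻¹ * X n i j) ^ 2 * v := by
          gcongr with i
          exact hvar n i
      _ = v * ((n : ℝ)⁻¹ * ∑ i, X n i j ^ 2) := by
          simp only [mul_pow, inv_pow, Real.sq_sqrt n.cast_nonneg, ← Finset.sum_mul,
            ← Finset.mul_sum]
          ring
      _ ≤ v * G := by
          gcongr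
          rwa [inv_mul_le_iff₀' (by positivity)]

end Noise

theorem mainTheorem2_general
    {Ω : Type*} [MeasurableSpace Ω] (P : Measure Ω) [IsProbabilityMeasure P]
    {p : ℕ}
    (X : (n : ℕ) → Matrix (Fin n) (Fin p) ℝ)
    (hX : ∀ j, (fun n => ∑ i, X n i j ^ 2) =O[atTop] fun n : ℕ => (n : ℝ))
    (βstar : Fin p → ℝ) (v : ℝ≥0)
    (ε : (n : ℕ) → Fin n → Ω → ℝ)
    (hε : ∀ n i, MemLp (ε n i) 2 P)
    (hε_mean : ∀ n i, ∫ ω, ε n i ω ∂P = 0) (hε_var : ∀ n i, Var[ε n i; P] ≤ v)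
    (hε_cov : ∀ n, Pairwise fun i j => cov[ε n i, ε n j; P] = 0)
    (m : ℕ → ℝ) (hm : ∀ᶠ n in atTop, 0 < m n)
    (hnm : (fun n : ℕ => (n : ℝ)) =O[atTop] m)
    (βtilde : ℕ → Ω → Fin p → ℝ)
    {Ω' : Type*} [MeasurableSpace Ω'] (P' : Measure Ω') [IsProbabilityMeasure P']
    (Z : Ω' → Fin p → ℝ)
    (hZ : TendstoInDistribution
      (fun n ω => √(m n) • (βtilde n ω - βstar)) atTop Z (fun _ => P) P')
    (γ₁ γ₂ : ℝ) (hγ₁ : 0 ≤ γ₁) (hγ₂ : 0 ≤ γ₂)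
    (lam eta : ℕ → ℝ)
    (h1 : Tendsto (fun n : ℕ => √(m n ^ γ₁ / n) * lam n) atTop atTop)
    (h2 : Tendsto (fun n : ℕ => eta n / √n) atTop atTop)
    (h3 : Tendsto (fun n => eta n / lam n) atTop atTop)
    (h4 : Tendsto (fun n => eta n / (√(m n ^ (γ₁ + γ₂)) * lam n)) atTop (𝓝 0))
    (βhat : ℕ → Ω → Fin p → ℝ) (hβhat : ∀ n, AEMeasurable (βhat n) P)
    (hmin : ∀ᶠ n in atTop, ∀ᵐ ω ∂P, IsAdaptiveTransferLasso (X n)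
      (linearResponse (X n) βstar (fun i => ε n i ω))
      (lam n) (eta n) γ₁ γ₂ (βtilde n ω) (βhat n ω)) :
    TendstoInDistribution
      (fun n ω => √(m n) • (βhat n ω - βstar)) atTop
      (fun ω' => (Function.support βstar).indicator (Z ω')) (fun _ => P) P' ∧
    Tendsto (fun n => P {ω | Function.support (βhat n ω) = Function.support βstar})
      atTop (𝓝 1) ∧
    Tendsto (fun n => P {ω | ∀ j ∈ Function.support βstar, βhat n ω j = βtilde n ω j})
      atTop (𝓝 1) := by
  have hbounded := (isBoundedInProbability_of_tendstoInDistribution hZ).prodMk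
    (isBoundedInProbability_normalized_score hX hε hε_mean hε_var hε_cov)
  have hfail : Tendsto (fun n => P {ω | ¬ (Function.support (βhat n ω) = Function.support βstar ∧
      ∀ j ∈ Function.support βstar, βhat n ω j = βtilde n ω j)}) atTop (𝓝 0) := by
    refine hbounded.tendsto_measure_not fun K hK => ?_
    filter_upwards [hmin, eventually_support_eq_and_apply_eq hm hnm hX hγ₁ hγ₂ h1 h2 h3 h4 βstar hK]
      with n hminn horacle
    filter_upwards [hminn] with ω hω hK
    exact horacle _ _ _ ((le_max_left _ _).trans hK) ((le_max_right _ _).trans hK) hω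
  refine ⟨?_, tendsto_measure_one_of_tendsto_measure_not hfail fun n ω h => h.1,
    tendsto_measure_one_of_tendsto_measure_not hfail fun n ω h => h.2⟩
  refine tendstoInDistribution_of_tendsto_measure_ne
    (hZ.continuous_comp (continuous_indicator_pi (Function.support βstar)))
    (fun n => ((hβhat n).sub_const βstar).const_smul (√(m n)))
    (tendsto_of_tendsto_of_tendsto_of_le_of_le tendsto_const_nhds hfail (fun _ => zero_le)
      fun n => measure_mono fun ω hne hgood => hne ?_)
  exact smul_sub_eq_indicator_of_support_eq hgood.1 hgood.2 (√(m n))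

lemma isBigO_sum_sq_of_tendsto_gram {p : ℕ} {X : (n : ℕ) → Matrix (Fin n) (Fin p) ℝ}
    {C : Matrix (Fin p) (Fin p) ℝ}
    (hXC : Tendsto (fun n : ℕ => (1 / (n : ℝ)) • ((X n)ᵀ * X n)) atTop (𝓝 C)) (j : Fin p) :
    (fun n => ∑ i, X n i j ^ 2) =O[atTop] fun n : ℕ => (n : ℝ) := by
  have hdiag : Tendsto (fun n : ℕ => (∑ i, X n i j ^ 2) / (n : ℝ)) atTop (𝓝 (C j j)) :=
    (tendsto_pi_nhds.1 (tendsto_pi_nhds.1 hXC j) j).congr fun n => by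
      simp [Matrix.mul_apply, sq, div_eq_inv_mul]
  refine Asymptotics.isBigO_of_div_tendsto_nhds ?_ (C j j) hdiag
  filter_upwards [eventually_gt_atTop 0] with n hn hn0
  exact absurd hn0 (by positivity)

theorem mainTheorem2
    {Ω : Type*} [MeasurableSpace Ω] (P : Measure Ω) [IsProbabilityMeasure P]
    {p : ℕ}
    -- linear model: design matrices, true parameter, i.i.d. Gaussian noise
    (X : (n : ℕ) → Matrix (Fin n) (Fin p) ℝ)
    (βstar : Fin p → ℝ) (σ : ℝ≥0)
    (ε : (n : ℕ) → Fin n → Ω → ℝ)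
    (hε_law : ∀ n i, HasLaw (ε n i) (gaussianReal 0 (σ ^ 2)) P)
    (hε_indep : ∀ n, iIndepFun (ε n) P)
    -- assumptions on the design
    (C : Matrix (Fin p) (Fin p) ℝ) (hC : C.PosDef)
    (hXC : Tendsto (fun n : ℕ => (1 / (n : ℝ)) • ((X n)ᵀ * X n)) atTop (𝓝 C))
    (hXmax : Tendsto (fun n : ℕ => (1 / (n : ℝ)) * ⨆ i, ∑ j, X n i j ^ 2) atTop (𝓝 0))
    -- source sample size
    (m : ℕ → ℕ) (hm : ∀ᶠ n in atTop, 0 < m n)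
    (r₀ : ℝ) (hr₀ : Tendsto (fun n : ℕ => (n : ℝ) / (m n : ℝ)) atTop (𝓝 r₀))
    -- initial estimator, independent of the target data,
    -- with `√m (β̃ - β*)` converging in distribution to some random vector `Z`
    (βtilde : ℕ → Ω → Fin p → ℝ) (hβtilde : ∀ n, AEMeasurable (βtilde n) P)
    (hindep : ∀ n, IndepFun (βtilde n) (fun ω i => ε n i ω) P)
    {Ω' : Type*} [MeasurableSpace Ω'] (P' : Measure Ω') [IsProbabilityMeasure P']
    (Z : Ω' → Fin p → ℝ)
    (hZ : TendstoInDistribution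
      (fun n ω => √(m n : ℝ) • (βtilde n ω - βstar)) atTop Z (fun _ => P) P')
    -- hyperparameters
    (γ₁ γ₂ : ℝ) (hγ₁ : 0 ≤ γ₁) (hγ₂ : 0 ≤ γ₂)
    (lam eta : ℕ → ℝ) (hlam : ∀ n, 0 ≤ lam n) (heta : ∀ n, 0 ≤ eta n)
    -- regime (ii)
    (h1 : Tendsto (fun n : ℕ => √((m n : ℝ) ^ γ₁ / (n : ℝ)) * lam n) atTop atTop)
    (h2 : Tendsto (fun n : ℕ => eta n / √(n : ℝ)) atTop atTop)
    (h3 : Tendsto (fun n : ℕ => eta n / lam n) atTop atTop)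
    (h4 : Tendsto (fun n : ℕ => eta n / (√((m n : ℝ) ^ (γ₁ + γ₂)) * lam n)) atTop (𝓝 0))
    -- the Adaptive Transfer Lasso estimator
    (βhat : ℕ → Ω → Fin p → ℝ) (hβhat : ∀ n, AEMeasurable (βhat n) P)
    (hmin : ∀ n, ∀ᵐ ω ∂P, IsAdaptiveTransferLasso (X n)
      (linearResponse (X n) βstar (fun i => ε n i ω))
      (lam n) (eta n) γ₁ γ₂ (βtilde n ω) (βhat n ω)) :
    -- `√m`-consistency, with the limit: `Z` on the active set, `0` off it
    TendstoInDistribution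
      (fun n ω => √(m n : ℝ) • (βhat n ω - βstar)) atTop
      (fun ω' => (Function.support βstar).indicator (Z ω')) (fun _ => P) P' ∧
    -- consistent active variable selection
    Tendsto (fun n => P {ω | Function.support (βhat n ω) = Function.support βstar})
      atTop (𝓝 1) ∧
    -- consistent invariant variable selection
    Tendsto (fun n => P {ω | ∀ j ∈ Function.support βstar, βhat n ω j = βtilde n ω j})
      atTop (𝓝 1) := by
  have hm' : ∀ᶠ n in atTop, (0 : ℝ) < m n := hm.mono fun n => Nat.cast_pos.2
  have hnm : (fun n : ℕ => (n : ℝ)) =O[atTop] fun n => (m n : ℝ) :=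
    Asymptotics.isBigO_of_div_tendsto_nhds (hm'.mono fun n hn hn0 => absurd hn0 hn.ne') r₀ hr₀
  have hε : ∀ n i, MemLp (ε n i) 2 P := fun n i => (hε_law n i).hasGaussianLaw.memLp_two
  exact mainTheorem2_general P X (isBigO_sum_sq_of_tendsto_gram hXC) βstar (σ ^ 2) ε hε
    (fun n i => (hε_law n i).integral_eq.trans integral_id_gaussianReal)
    (fun n i => ((hε_law n i).variance_eq.trans variance_id_gaussianReal).le)
    (fun n i j hij => ((hε_indep n).indepFun hij).covariance_eq_zero (hε n i) (hε n j))
    (fun n => m n) hm' hnm βtilde P' Z hZ γ₁ γ₂ hγ₁ hγ₂ lam eta h1 h2 h3 h4 βhat hβhat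
    (.of_forall hmin)
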